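/- Let $\mathbb H$ be the division algebra of real quaternions, with the usual units $i,j,k$. For $A\in M(n,\mathbb H)$ write $A=A_1+A_2\,j$ with $A_1,A_2\in M(n,\mathbb C)$ and set $$\det A:=\det\begin{pmatrix}A_1&A_2\\-\overline{A_2}&\overline{A_1}\end{pmatrix}.$$ Let $\mathrm{SL}(n,\mathbb H)$ be the group of matrices in $M(n,\mathbb H)$ with $\det A=1$, and let $\mathrm{PSL}(n,\mathbb H):=\mathrm{SL}(n,\mathbb H)/\{\pm I_n\}$. An involution in a group $G$ is an element $s\in G$ with $s^2=1$. An element $g\in G$ is called reversible if it is conjugate to $g^{-1}$ in $G$, and strongly reversible if $sgs^{-1}=g^{-1}$ for some involution $s\in G$ (equivalently, if $g$ is a product of two involutions in $G$). Theorem. For every $n$, an element of $\mathrm{PSL}(n,\mathbb H)$ is reversible in $\mathrm{PSL}(n,\mathbb H)$ if and only if it is strongly reversible in $\mathrm{PSL}(n,\mathbb H)$. -/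

import Mathlib

open scoped Quaternion

section Reversibility

variable {G : Type*} [Group G]

/-- An involution is an element of order at most two (so the identity is allowed). -/
def IsInvolutionElt (s : G) : Prop := s ^ 2 = 1

/-- `g` is reversible if it is conjugate to its own inverse. -/
def IsReversibleElt (g : G) : Prop := IsConj g g⁻¹

/-- `g` is strongly reversible if it is conjugate to its own inverse by an involution. -/
def IsStronglyReversibleElt (g : G) : Prop :=
  ∃ s : G, IsInvolutionElt s ∧ s * g * s⁻¹ = g⁻¹

/-- Strongly reversible elements are exactly the products of two involutions. -/
theorem isStronglyReversibleElt_iff_prod (g : G) :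
    IsStronglyReversibleElt g ↔
      ∃ s t : G, IsInvolutionElt s ∧ IsInvolutionElt t ∧ g = s * t := by
  constructor
  · rintro ⟨s, hs, h⟩
    unfold IsInvolutionElt at *
    have hs' : s⁻¹ = s := inv_eq_of_mul_eq_one_left (by rw [← pow_two, hs])
    refine ⟨s, s * g, hs, ?_, ?_⟩
    · have h2 : s * g * s = g⁻¹ := by rw [← h, hs']
      rw [pow_two, ← mul_assoc, h2, inv_mul_cancel]
    · rw [← mul_assoc, ← pow_two, hs, one_mul]
  · rintro ⟨s, t, hs, ht, rfl⟩
    unfold IsInvolutionElt at *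
    have ht' : t⁻¹ = t := inv_eq_of_mul_eq_one_left (by rw [← pow_two, ht])
    have hs' : s⁻¹ = s := inv_eq_of_mul_eq_one_left (by rw [← pow_two, hs])
    refine ⟨s, hs, ?_⟩
    rw [mul_inv_rev, ht', hs', ← mul_assoc, ← pow_two, hs, one_mul]

end Reversibility

noncomputable section QuaternionicGroups

/-- The complex number `a + b i`, where `q = (a + b i) + (c + d i) j`. -/
def quatFst (q : ℍ[ℝ]) : ℂ := ⟨q.re, q.imI⟩

/-- The complex number `c + d i`, where `q = (a + b i) + (c + d i) j`. -/
def quatSnd (q : ℍ[ℝ]) : ℂ := ⟨q.imJ, q.imK⟩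

theorem quatFst_add (p q : ℍ[ℝ]) : quatFst (p + q) = quatFst p + quatFst q := by
  apply Complex.ext <;> simp [quatFst]

theorem quatSnd_add (p q : ℍ[ℝ]) : quatSnd (p + q) = quatSnd p + quatSnd q := by
  apply Complex.ext <;> simp [quatSnd]

theorem quatFst_mul (p q : ℍ[ℝ]) :
    quatFst (p * q) = quatFst p * quatFst q - quatSnd p * star (quatSnd q) := by
  apply Complex.ext <;> simp [quatFst, quatSnd] <;> ring

theorem quatSnd_mul (p q : ℍ[ℝ]) :
    quatSnd (p * q) = quatFst p * quatSnd q + quatSnd p * star (quatFst q) := by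
  apply Complex.ext <;> simp [quatFst, quatSnd] <;> ring

theorem quatFst_sum {ι : Type*} (s : Finset ι) (f : ι → ℍ[ℝ]) :
    quatFst (∑ k ∈ s, f k) = ∑ k ∈ s, quatFst (f k) :=
  map_sum (AddMonoidHom.mk' quatFst quatFst_add) f s

theorem quatSnd_sum {ι : Type*} (s : Finset ι) (f : ι → ℍ[ℝ]) :
    quatSnd (∑ k ∈ s, f k) = ∑ k ∈ s, quatSnd (f k) :=
  map_sum (AddMonoidHom.mk' quatSnd quatSnd_add) f s

/-- The embedding of `M(n, ℍ)` into `M(2n, ℂ)` that sends `A = A₁ + A₂ j`, with `A₁`, `A₂` complex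
matrices, to the block matrix with rows `(A₁, A₂)` and `(-conj A₂, conj A₁)`. -/
def quatEmbed (n : ℕ) (A : Matrix (Fin n) (Fin n) ℍ[ℝ]) :
    Matrix (Fin n ⊕ Fin n) (Fin n ⊕ Fin n) ℂ :=
  Matrix.fromBlocks (A.map quatFst) (A.map quatSnd)
    (-(A.map quatSnd).map star) ((A.map quatFst).map star)

theorem quatEmbed_one (n : ℕ) : quatEmbed n 1 = 1 := by
  have h1 : (1 : Matrix (Fin n) (Fin n) ℍ[ℝ]).map quatFst = 1 := by
    ext i j
    by_cases h : i = j <;> simp [Matrix.one_apply, h, quatFst, Complex.ext_iff]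
  have h2 : (1 : Matrix (Fin n) (Fin n) ℍ[ℝ]).map quatSnd = 0 := by
    ext i j
    by_cases h : i = j <;> simp [h, quatSnd, Complex.ext_iff]
  have h3 : (1 : Matrix (Fin n) (Fin n) ℂ).map star = 1 :=
    Matrix.map_one _ (star_zero _) (star_one _)
  have h4 : (0 : Matrix (Fin n) (Fin n) ℂ).map star = 0 := by ext; simp
  rw [quatEmbed, h1, h2, h3, h4, neg_zero, Matrix.fromBlocks_one]

theorem quatEmbed_mul (n : ℕ) (A B : Matrix (Fin n) (Fin n) ℍ[ℝ]) :
    quatEmbed n (A * B) = quatEmbed n A * quatEmbed n B := by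
  rw [quatEmbed, quatEmbed, quatEmbed, Matrix.fromBlocks_multiply]
  congr 1
  · ext i j
    simp only [Matrix.map_apply, Matrix.mul_apply, Matrix.add_apply, Matrix.neg_apply, quatFst_sum,
      quatFst_mul, ← Finset.sum_add_distrib]
    exact Finset.sum_congr rfl fun k _ => by ring
  · ext i j
    simp only [Matrix.map_apply, Matrix.mul_apply, Matrix.add_apply, quatSnd_sum,
      quatSnd_mul, ← Finset.sum_add_distrib]
  · ext i j
    simp only [Matrix.map_apply, Matrix.mul_apply, Matrix.add_apply, Matrix.neg_apply, quatSnd_sum,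
      quatSnd_mul, star_sum, star_add, star_mul', star_star, ← Finset.sum_add_distrib,
      ← Finset.sum_neg_distrib]
    exact Finset.sum_congr rfl fun k _ => by ring
  · ext i j
    simp only [Matrix.map_apply, Matrix.mul_apply, Matrix.add_apply, Matrix.neg_apply, quatFst_sum,
      quatFst_mul, star_sum, star_sub, star_mul', star_star, ← Finset.sum_add_distrib]
    exact Finset.sum_congr rfl fun k _ => by ring

/-- The quaternionic determinant `det A := det (Φ A)`, where `Φ` is the embedding into
`M(2n, ℂ)`, as a monoid homomorphism. -/
def quatDet (n : ℕ) : Matrix (Fin n) (Fin n) ℍ[ℝ] →* ℂ where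
  toFun A := (quatEmbed n A).det
  map_one' := by rw [quatEmbed_one, Matrix.det_one]
  map_mul' A B := by rw [quatEmbed_mul, Matrix.det_mul]

/-- A quaternionic matrix is invertible exactly when its determinant is nonzero. -/
theorem isUnit_iff_quatDet_ne_zero (n : ℕ) (A : Matrix (Fin n) (Fin n) ℍ[ℝ]) :
    IsUnit A ↔ quatDet n A ≠ 0 := by
  constructor
  · intro h
    exact (h.map (quatDet n)).ne_zero
  · intro h
    have hE : IsUnit (quatEmbed n A) :=
      (Matrix.isUnit_iff_isUnit_det _).2 (isUnit_iff_ne_zero.2 h)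
    have hinj : Function.Injective (quatEmbed n) := by
      intro X Y hXY
      obtain ⟨hF, hS, -, -⟩ := Matrix.fromBlocks_inj.1 hXY
      ext i j
      · exact congrArg Complex.re (congrFun (congrFun hF i) j)
      · exact congrArg Complex.im (congrFun (congrFun hF i) j)
      · exact congrArg Complex.re (congrFun (congrFun hS i) j)
      · exact congrArg Complex.im (congrFun (congrFun hS i) j)
    have hreg : IsRightRegular A := by
      intro X Y hXY
      apply hinj
      apply hE.mul_left_injective
      change quatEmbed n X * quatEmbed n A = quatEmbed n Y * quatEmbed n A
      rw [← quatEmbed_mul, ← quatEmbed_mul]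
      exact congrArg _ hXY
    have : IsArtinianRing (Matrix (Fin n) (Fin n) ℍ[ℝ]) := IsArtinianRing.of_finite ℝ _
    exact IsArtinianRing.isUnit_iff_isRightRegular.2 hreg

/-- `SL(n, ℍ)`: the invertible quaternionic matrices of quaternionic determinant one. -/
def SLQuat (n : ℕ) : Subgroup (Matrix.GeneralLinearGroup (Fin n) ℍ[ℝ]) where
  carrier := {g | quatDet n g.val = 1}
  one_mem' := by
    change quatDet n 1 = 1
    exact map_one _
  mul_mem' {a b} ha hb := by
    change quatDet n (a.val * b.val) = 1
    change quatDet n a.val = 1 at ha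
    change quatDet n b.val = 1 at hb
    rw [map_mul, ha, hb, one_mul]
  inv_mem' {a} ha := by
    change quatDet n a.val = 1 at ha
    change quatDet n a⁻¹.val = 1
    have h : quatDet n (a.val * a⁻¹.val) = 1 := by rw [Units.mul_inv, map_one]
    rwa [map_mul, ha, one_mul] at h

/-- The subgroup `{I, -I}` of `SL(n, ℍ)`. -/
def SLQuatPMOne (n : ℕ) : Subgroup (SLQuat n) where
  carrier := {g | g.val = 1 ∨ g.val = -1}
  one_mem' := Or.inl rfl
  mul_mem' {a b} ha hb := by
    change a.val * b.val = 1 ∨ a.val * b.val = -1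
    rcases ha with ha | ha <;> rcases hb with hb | hb <;> rw [ha, hb] <;> simp
  inv_mem' {a} ha := by
    change a.val⁻¹ = 1 ∨ a.val⁻¹ = -1
    rcases ha with ha | ha <;> rw [ha] <;> simp

/-- `-I` does lie in `SL(n, ℍ)`. -/
theorem neg_one_mem_SLQuat (n : ℕ) : (-1 : Matrix.GeneralLinearGroup (Fin n) ℍ[ℝ]) ∈ SLQuat n := by
  have h : quatEmbed n (-1) = -1 := by
    rw [← quatEmbed_one n, quatEmbed, quatEmbed, Matrix.fromBlocks_neg]
    congr 1
  change (quatEmbed n (-1)).det = 1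
  rw [h, Matrix.det_neg, Matrix.det_one, mul_one, Fintype.card_sum]
  exact Even.neg_one_pow ⟨_, rfl⟩

instance SLQuatPMOne_normal (n : ℕ) : (SLQuatPMOne n).Normal where
  conj_mem a ha g := by
    change g.val * a.val * g.val⁻¹ = 1 ∨ g.val * a.val * g.val⁻¹ = -1
    rcases ha with ha | ha <;> rw [ha] <;> simp

/-- `PSL(n, ℍ) = SL(n, ℍ) / {I, -I}`, with its quotient group structure. -/
abbrev PSLQuat (n : ℕ) : Type := SLQuat n ⧸ SLQuatPMOne n

end QuaternionicGroups

/-! Lift the element to `a` in `SL(n, ℍ)`: reversibility says that some `c` satisfies `c a c⁻¹ = ε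
a⁻¹` with `ε = ±1`. It suffices to replace `c` by some `S` with `S * S = -1`: its class is an
involution, and it has determinant one automatically (`quatDet_eq_one_of_mul_self_eq_neg_one`).

Such an `S` is built by Fitting decomposition (`skewIntertwined_of_intertwined`). Put `k = ε g⁻¹`,
take an irreducible real factor `p` of the minimal polynomial of `g`, and split off the part where
`p(g) p(k)` is nilpotent. If `p` is coprime to the reciprocal polynomial describing `p(k)`, the
given intertwiner swaps the two primary components, and it can be corrected to have square `-1`
(`skewIntertwined_of_isCoprime`). Otherwise `p(g)` itself is nilpotent, and `g = S (1 + N) (1 -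
N)⁻¹` with `N` nilpotent and `S` either `±1` or `t + r I` with `I * I = -1`. Inverting `g` inverts
`S` and negates `N`, so one needs a square root of `-1` that anticommutes with `N` and carries `S`
to `ε S⁻¹`. On a Jordan basis it is a quaternion unit with signs alternating along the chains
(`exists_anticommute_of_basis`). -/

/-! ### Jordan bases over division rings -/

section JordanBasis

variable {D V : Type*} [DivisionRing D] [AddCommGroup V] [Module D V]

/-- `B` is a Jordan set for `N`: it is linearly independent, `N` maps each of its elements to zero
or to another of its elements, and no two elements have the same nonzero image. -/
structure IsJordanSet (N : Module.End D V) (B : Set V) : Prop where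
  linearIndepOn : LinearIndepOn D id B
  map_mem : ∀ b ∈ B, N b = 0 ∨ N b ∈ B
  inj : ∀ b ∈ B, ∀ c ∈ B, N b ≠ 0 → N b = N c → b = c

/-- Induction step for Jordan bases: prolong every chain of `N U` by a preimage of its top vector,
then complete the bottoms of the chains to a basis of `U ⊓ N.ker`. -/
theorem IsJordanSet.exists_extension {N : Module.End D V} {U : Submodule D V} {B : Set V}
    (hB : IsJordanSet N B) (hBU : Submodule.span D B = U.map N) (hNU : U.map N ≤ U) :
    ∃ B' : Set V, IsJordanSet N B' ∧ Submodule.span D B' = U := by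
  have hBU' : ∀ b ∈ B, b ∈ U := fun b hb => hNU (hBU ▸ Submodule.subset_span hb)
  -- Preferring a preimage already in `B` keeps the old chains intact, so that only their tops gain
  -- a new vector.
  have hpre : ∀ b : B, ∃ c ∈ U, N c = b ∧ ((∃ b' ∈ B, N b' = b) → c ∈ B) := by
    rintro ⟨b, hb⟩
    by_cases h : ∃ b' ∈ B, N b' = b
    · obtain ⟨b', hb', h'⟩ := h
      exact ⟨b', hBU' b' hb', h', fun _ => hb'⟩
    · have hb' : b ∈ U.map N := hBU ▸ Submodule.subset_span hb
      obtain ⟨c, hc, hcb⟩ := Submodule.mem_map.1 hb'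
      exact ⟨c, hc, hcb, fun h' => absurd h' h⟩
  choose c hcU hcN hcB using hpre
  have hindN : LinearIndependent D (N ∘ c) := by
    have : (N ∘ c) = fun b : B => (b : V) := funext hcN
    rw [this]
    exact hB.linearIndepOn
  have hind : LinearIndepOn D id (Set.range c) :=
    (LinearIndependent.of_comp N hindN).linearIndepOn_id
  have hdisj := Submodule.range_ker_disjoint hindN
  have hE0 : LinearIndepOn D id (B ∩ {b | N b = 0}) := hB.linearIndepOn.mono Set.inter_subset_left
  obtain ⟨E, hEt, hE0E, htE, hEind⟩ := exists_linearIndepOn_id_extension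
    (t := ((U ⊓ N.ker : Submodule D V) : Set V)) hE0 (fun b hb => ⟨hBU' b hb.1, hb.2⟩)
  have hEspan : Submodule.span D E ≤ U ⊓ N.ker := Submodule.span_le.2 hEt
  have hBC : ∀ b ∈ B, N b ≠ 0 → b ∈ Set.range c := by
    intro b hb hne
    have hNb : N b ∈ B := (hB.map_mem b hb).resolve_left hne
    refine ⟨⟨N b, hNb⟩, ?_⟩
    exact (hB.inj b hb _ (hcB ⟨N b, hNb⟩ ⟨b, hb, rfl⟩) hne (hcN ⟨N b, hNb⟩).symm).symm
  have hE : ∀ e ∈ E, N e = 0 := fun e he => (hEt he).2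
  refine ⟨Set.range c ∪ E, ⟨?_, ?_, ?_⟩, ?_⟩
  · exact hind.id_union hEind (hdisj.mono_right (hEspan.trans inf_le_right))
  · rintro x (⟨b, rfl⟩ | hx)
    · right
      rw [hcN]
      by_cases h : N b = 0
      · exact Or.inr (hE0E ⟨b.2, h⟩)
      · exact Or.inl (hBC b b.2 h)
    · exact Or.inl (hE x hx)
  · rintro x (⟨b, rfl⟩ | hx) y (⟨b', rfl⟩ | hy) hne hxy
    · rw [hcN, hcN] at hxy
      rw [Subtype.ext hxy]
    · exact absurd (hxy.trans (hE y hy)) hne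
    · exact absurd (hE x hx) hne
    · exact absurd (hE x hx) hne
  · rw [Submodule.span_union]
    apply le_antisymm
    · refine sup_le (Submodule.span_le.2 ?_) (hEspan.trans inf_le_left)
      rintro _ ⟨b, rfl⟩
      exact hcU b
    · intro x hx
      have hNx : N x ∈ (Submodule.span D (Set.range c)).map N := by
        have hBr : N '' Set.range c = B := by
          rw [← Set.range_comp, show (N ∘ c) = fun b : B => (b : V) from funext hcN]
          exact Subtype.range_coe
        rw [Submodule.map_span, hBr, hBU]
        exact Submodule.mem_map_of_mem hx
      obtain ⟨y, hy, hyx⟩ := Submodule.mem_map.1 hNx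
      have hyU : y ∈ U := by
        refine (Submodule.span_le.2 ?_ : Submodule.span D (Set.range c) ≤ U) hy
        rintro _ ⟨b, rfl⟩
        exact hcU b
      refine Submodule.mem_sup.2 ⟨y, hy, x - y, htE ⟨U.sub_mem hx hyU, ?_⟩, by abel⟩
      change N (x - y) = 0
      rw [map_sub, hyx, sub_self]

/-- A nilpotent endomorphism of a vector space over a division ring has a Jordan basis. -/
theorem exists_isJordanSet_span_eq_top {N : Module.End D V} (hN : IsNilpotent N) :
    ∃ B : Set V, IsJordanSet N B ∧ Submodule.span D B = ⊤ := by
  obtain ⟨m, hm⟩ := hN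
  -- Climb from the range of `N ^ m`, which is zero, to that of `N ^ 0`; each range is the image
  -- under `N` of the next. No finiteness of dimension is needed.
  have key : ∀ k ≤ m, ∃ B : Set V, IsJordanSet N B ∧
      Submodule.span D B = (N ^ (m - k)).range := by
    intro k
    induction k with
    | zero =>
      intro _
      refine ⟨∅, ⟨linearIndepOn_empty D id, by simp, by simp⟩, ?_⟩
      simp [hm]
    | succ k ih =>
      intro hk
      obtain ⟨B, hB, hs⟩ := ih (by omega)
      obtain ⟨d, hd⟩ : ∃ d, m = d + k + 1 := ⟨m - (k + 1), by omega⟩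
      have h1 : m - k = d + 1 := by omega
      have h2 : m - (k + 1) = d := by omega
      rw [h1] at hs
      rw [h2]
      refine hB.exists_extension ?_ ?_
      · rw [hs, pow_succ']
        exact LinearMap.range_comp _ _
      · rintro _ ⟨_, ⟨y, rfl⟩, rfl⟩
        refine ⟨N y, ?_⟩
        rw [← Module.End.mul_apply, ← Module.End.mul_apply, ← pow_succ, ← pow_succ']
  obtain ⟨B, hB, hs⟩ := key m le_rfl
  exact ⟨B, hB, by simpa [Module.End.one_eq_id] using hs⟩

/-- The parity sign of the number of times `N` has to be applied to kill `v`. -/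
noncomputable def nilSign (N : Module.End D V) (v : V) : ℤ :=
  (-1) ^ sInf {m : ℕ | (N ^ m) v = 0}

theorem nilSign_mul_self (N : Module.End D V) (v : V) : nilSign N v * nilSign N v = 1 := by
  rw [nilSign, ← pow_add, Even.neg_one_pow ⟨_, rfl⟩]

/-- As long as `N v ≠ 0`, applying `N` lowers the order of `v` by exactly one. -/
theorem nilSign_apply {N : Module.End D V} (hN : IsNilpotent N) {v : V} (hv : N v ≠ 0) :
    nilSign N (N v) = -nilSign N v := by
  have hne : ∀ w, {m : ℕ | (N ^ m) w = 0}.Nonempty := by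
    obtain ⟨m, hm⟩ := hN
    exact fun w => ⟨m, by simp [hm]⟩
  have hs : ∀ m, (N ^ m) (N v) = (N ^ (m + 1)) v := fun m => by
    rw [pow_succ, Module.End.mul_apply]
  have h : sInf {m : ℕ | (N ^ m) v = 0} = sInf {m : ℕ | (N ^ m) (N v) = 0} + 1 := by
    apply le_antisymm
    · apply Nat.sInf_le
      have := Nat.sInf_mem (hne (N v))
      rw [Set.mem_ofPred_eq, hs] at this
      exact this
    · have h1 := Nat.sInf_mem (hne v)
      obtain ⟨d, hd⟩ | h0 := (sInf {m : ℕ | (N ^ m) v = 0}).eq_zero_or_eq_succ_pred.symm.imp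
        (fun h => (⟨_, h⟩ : ∃ d, sInf {m : ℕ | (N ^ m) v = 0} = Nat.succ d)) id
      · rw [hd] at h1 ⊢
        refine Nat.succ_le_succ (Nat.sInf_le ?_)
        rw [Set.mem_ofPred_eq, hs]
        exact h1
      · rw [h0] at h1
        exact absurd (by simpa using congrArg N (show v = 0 by simpa using h1)) hv
  rw [nilSign, nilSign, h, pow_succ]
  ring

/-- A nilpotent endomorphism with a Jordan basis anticommutes with a square root of `-1` that acts
on each basis vector by plus or minus the scalar `q`. -/
theorem exists_anticommute_of_basis {ι : Type*} {N : Module.End D V} (hN : IsNilpotent N)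
    (b : Module.Basis ι D V) (hb : ∀ i, N (b i) = 0 ∨ ∃ j, N (b i) = b j) {q : D} (hq : q * q = -1) :
    ∃ s : Module.End D V, s * s = -1 ∧ s * N = -(N * s) ∧
      ∀ i, s (b i) = q • b i ∨ s (b i) = -(q • b i) := by
  -- The sign alternates along each chain, which gives anticommutation; being an integer it is
  -- central, so the square only sees `q * q`.
  let s : Module.End D V := b.constr ℕ fun i => nilSign N (b i) • q • b i
  have hs : ∀ i, s (b i) = nilSign N (b i) • q • b i := fun i => b.constr_basis ℕ _ i
  refine ⟨s, b.ext fun i => ?_, b.ext fun i => ?_, fun i => ?_⟩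
  · rw [Module.End.mul_apply, hs, map_zsmul, map_smul, hs, smul_comm q, smul_smul q, hq, smul_smul,
      nilSign_mul_self]
    simp
  · rw [LinearMap.neg_apply, Module.End.mul_apply, Module.End.mul_apply, hs, map_zsmul, map_smul]
    rcases hb i with h | ⟨j, hj⟩
    · simp [h]
    · rw [hj, hs, ← hj, nilSign_apply hN (hj ▸ b.ne_zero j), neg_smul]
  · rw [hs]
    rcases neg_one_pow_eq_or ℤ (sInf {m : ℕ | (N ^ m) (b i) = 0}) with h | h
    · left; rw [nilSign, h, one_smul]
    · right; rw [nilSign, h, neg_smul, one_smul]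

theorem exists_anticommute_of_isNilpotent {N : Module.End D V} (hN : IsNilpotent N) {q : D}
    (hq : q * q = -1) : ∃ s : Module.End D V, s * s = -1 ∧ s * N = -(N * s) := by
  obtain ⟨B, hB, hs⟩ := exists_isJordanSet_span_eq_top hN
  have hB1 : LinearIndependent D ((↑) : B → V) := hB.linearIndepOn
  have hB2 : ⊤ ≤ Submodule.span D (Set.range ((↑) : B → V)) := by rw [Subtype.range_coe, hs]
  obtain ⟨s, h1, h2, -⟩ := exists_anticommute_of_basis hN (Module.Basis.mk hB1 hB2) (fun i => by
    simp only [Module.Basis.mk_apply]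
    exact (hB.map_mem i i.2).imp_right fun h => ⟨⟨_, h⟩, rfl⟩) hq
  exact ⟨s, h1, h2⟩

end JordanBasis

/-! ### Quaternionic spaces with a commuting complex structure -/

section ComplexStructure

variable {V : Type*} [AddCommGroup V] [Module ℍ[ℝ] V]

/-- The quaternion unit `i`. -/
def quatI : ℍ[ℝ] := ⟨0, 1, 0, 0⟩

/-- The quaternion unit `j`. -/
def quatJ : ℍ[ℝ] := ⟨0, 0, 1, 0⟩

@[simp] theorem re_quatI : quatI.re = 0 := rfl

@[simp] theorem imI_quatI : quatI.imI = 1 := rfl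

@[simp] theorem imJ_quatI : quatI.imJ = 0 := rfl

@[simp] theorem imK_quatI : quatI.imK = 0 := rfl

@[simp] theorem re_quatJ : quatJ.re = 0 := rfl

@[simp] theorem imI_quatJ : quatJ.imI = 0 := rfl

@[simp] theorem imJ_quatJ : quatJ.imJ = 1 := rfl

@[simp] theorem imK_quatJ : quatJ.imK = 0 := rfl

theorem quaternion_two_ne_zero : (2 : ℍ[ℝ]) ≠ 0 := by
  have h : ((2 : ℝ) : ℍ[ℝ]) ≠ 0 := fun h => two_ne_zero (congrArg (fun q : ℍ[ℝ] => q.re) h)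
  exact_mod_cast h

theorem quatI_mul_self : quatI * quatI = -1 := by
  ext <;> simp

theorem quatJ_mul_self : quatJ * quatJ = -1 := by
  ext <;> simp

theorem quatJ_mul_quatI : quatJ * quatI = -(quatI * quatJ) := by
  ext <;> simp

theorem ofComplex_mul_quatI (z : ℂ) :
    Quaternion.ofComplex z * quatI = quatI * Quaternion.ofComplex z := by
  ext <;> simp

theorem ofComplex_add_quatJ_mul (q : ℍ[ℝ]) :
    Quaternion.ofComplex (quatFst q) + quatJ * Quaternion.ofComplex (star (quatSnd q)) = q := by
  ext <;> simp [quatFst, quatSnd]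

theorem quatI_smul_quatI_smul (v : V) : quatI • quatI • v = -v := by
  rw [smul_smul, quatI_mul_self, neg_smul, one_smul]

theorem quatJ_smul_quatJ_smul (v : V) : quatJ • quatJ • v = -v := by
  rw [smul_smul, quatJ_mul_self, neg_smul, one_smul]

theorem quatJ_smul_quatI_smul (v : V) : quatJ • quatI • v = -(quatI • quatJ • v) := by
  rw [smul_smul, quatJ_mul_quatI, neg_smul, ← smul_smul]

/-- Since `j` anticommutes with `i`, `I` acts on `j y` as `-i`. Applying `I` to the relation
therefore yields `x = j y` besides `x = -j y`. -/
theorem eq_zero_of_add_quatJ_smul_eq_zero {I : Module.End ℍ[ℝ] V} {x y : V} (hx : I x = quatI • x) (hy : I y = quatI • y)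
    (h : x + quatJ • y = 0) : x = 0 ∧ y = 0 := by
  have h1 : quatI • x + quatJ • quatI • y = 0 := by
    have := congrArg I h
    rwa [map_add, map_smul, hx, hy, map_zero] at this
  have h2 : quatI • (x - quatJ • y) = 0 := by
    rw [← h1, quatJ_smul_quatI_smul, smul_sub, sub_eq_add_neg]
  have hI : quatI ≠ 0 := fun h => by simpa [h] using quatI_mul_self
  have hJ : quatJ ≠ 0 := fun h => by simpa [h] using quatJ_mul_self
  have h3 := sub_eq_zero.1 ((smul_eq_zero_iff_right hI).1 h2)
  have h4 : x = 0 := by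
    rw [← h3] at h
    have h2x : (2 : ℍ[ℝ]) • x = 0 := by rw [two_smul, h]
    exact (smul_eq_zero_iff_right quaternion_two_ne_zero).1 h2x
  exact ⟨h4, (smul_eq_zero_iff_right hJ).1 (h3.symm.trans h4)⟩

variable [Module ℂ V]

/-- The complex subspace on which `I` acts as the scalar `i`. -/
def complexPart (hc : ∀ (z : ℂ) (v : V), z • v = Quaternion.ofComplex z • v)
    (I : Module.End ℍ[ℝ] V) : Submodule ℂ V where
  carrier := {v | I v = quatI • v}
  add_mem' {a b} ha hb := by
    change I (a + b) = quatI • (a + b)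
    rw [map_add, smul_add, show I a = _ from ha, show I b = _ from hb]
  zero_mem' := by
    change I 0 = quatI • (0 : V)
    simp
  smul_mem' z v hv := by
    change I (z • v) = quatI • (z • v)
    rw [hc, map_smul, show I v = _ from hv, smul_smul, smul_smul, ofComplex_mul_quatI]

variable (hc : ∀ (z : ℂ) (v : V), z • v = Quaternion.ofComplex z • v) {I : Module.End ℍ[ℝ] V}

include hc in
theorem linearIndependent_of_complexPart {ι : Type*} {v : ι → complexPart hc I}
    (hv : LinearIndependent ℂ v) : LinearIndependent ℍ[ℝ] fun i => (v i : V) := by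
  rw [linearIndependent_iff'] at hv ⊢
  intro s g hg i hi
  -- Each coefficient is written `z + j w` with `z`, `w` complex; moving `j` to the left is what
  -- conjugates the second component.
  have hsum : ((∑ i ∈ s, quatFst (g i) • v i : complexPart hc I) : V) +
      quatJ • ((∑ i ∈ s, star (quatSnd (g i)) • v i : complexPart hc I) : V) = 0 := by
    rw [← hg]
    simp only [Submodule.coe_sum, Submodule.coe_smul, hc, Finset.smul_sum, ← Finset.sum_add_distrib]
    refine Finset.sum_congr rfl fun i _ => ?_
    rw [smul_smul, ← add_smul, ofComplex_add_quatJ_mul]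
  obtain ⟨h1, h2⟩ := eq_zero_of_add_quatJ_smul_eq_zero 
    (∑ i ∈ s, quatFst (g i) • v i).2 (∑ i ∈ s, star (quatSnd (g i)) • v i).2 hsum
  have h3 := hv s _ (Subtype.ext h1) i hi
  have h4 := hv s _ (Subtype.ext h2) i hi
  rw [← ofComplex_add_quatJ_mul (g i), h3, h4]
  simp

include hc in
-- Up to a factor two, `v` is the sum of `v - i I v` and `v + i I v`, on which `I` acts as `i` and
-- `-i`; multiplication by `j` moves the latter into the complex part.
theorem span_complexPart_eq_top (hI : I * I = -1) :
    Submodule.span ℍ[ℝ] (complexPart hc I : Set V) = ⊤ := by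
  rw [eq_top_iff]
  intro v _
  have hII : I (I v) = -v := by rw [← Module.End.mul_apply, hI]; rfl
  have hx : v - quatI • I v ∈ complexPart hc I := by
    change I _ = quatI • _
    rw [map_sub, map_smul, hII, smul_sub, quatI_smul_quatI_smul]
    simp [add_comm]
  have hy : quatJ • (v + quatI • I v) ∈ complexPart hc I := by
    change I _ = quatI • _
    rw [map_smul, map_add, map_smul, hII]
    simp only [smul_add, smul_neg, quatJ_smul_quatI_smul, quatI_smul_quatI_smul]
    abel
  have hv : v = (2⁻¹ : ℍ[ℝ]) • ((v - quatI • I v) - quatJ • quatJ • (v + quatI • I v)) := by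
    rw [quatJ_smul_quatJ_smul, show v - quatI • I v - -(v + quatI • I v) = (2 : ℍ[ℝ]) • v by
      rw [two_smul]; abel, smul_smul, inv_mul_cancel₀ quaternion_two_ne_zero, one_smul]
  rw [hv]
  exact Submodule.smul_mem _ _ (Submodule.sub_mem _ (Submodule.subset_span hx)
    (Submodule.smul_mem _ _ (Submodule.subset_span hy)))

include hc in
-- A complex Jordan basis of `N` on the `i`-part of `I` is also a quaternionic Jordan basis of the
-- whole space.
theorem exists_basis_of_complex_structure (hI : I * I = -1) {N : Module.End ℍ[ℝ] V}
    (hN : IsNilpotent N) (hIN : Commute I N) :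
    ∃ (ι : Set V) (b : Module.Basis ι ℍ[ℝ] V), (∀ i, I (b i) = quatI • b i) ∧
      ∀ i, N (b i) = 0 ∨ ∃ j, N (b i) = b j := by
  have hmaps : ∀ v ∈ complexPart hc I, N v ∈ complexPart hc I := by
    intro v hv
    change I (N v) = quatI • N v
    rw [← Module.End.mul_apply, hIN.eq, Module.End.mul_apply, show I v = _ from hv, map_smul]
  let N₀ : Module.End ℂ (complexPart hc I) :=
    { toFun := fun v => ⟨N v, hmaps v v.2⟩
      map_add' := fun v w => Subtype.ext (map_add N _ _)
      map_smul' := fun z v => Subtype.ext (by simp [hc]) }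
  have hpow : ∀ (m : ℕ) (v : complexPart hc I), (((N₀ ^ m) v : complexPart hc I) : V)
      = (N ^ m) v := by
    intro m
    induction m with
    | zero => intro v; rfl
    | succ m ih =>
      intro v
      rw [pow_succ, pow_succ, Module.End.mul_apply, Module.End.mul_apply, ih]
      rfl
  have hN₀ : IsNilpotent N₀ := by
    obtain ⟨m, hm⟩ := hN
    refine ⟨m, LinearMap.ext fun v => Subtype.ext ?_⟩
    rw [hpow, hm]
    rfl
  obtain ⟨B, hB, hs⟩ := exists_isJordanSet_span_eq_top hN₀
  have hli : LinearIndependent ℍ[ℝ] fun b : B => ((b : complexPart hc I) : V) :=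
    linearIndependent_of_complexPart hc hB.linearIndepOn
  have hsp : ⊤ ≤ Submodule.span ℍ[ℝ] (Set.range fun b : B => ((b : complexPart hc I) : V)) := by
    rw [← span_complexPart_eq_top hc hI, Submodule.span_le]
    intro v hv
    have hmem : (⟨v, hv⟩ : complexPart hc I) ∈ Submodule.span ℂ B := hs ▸ Submodule.mem_top
    suffices h : ∀ x ∈ Submodule.span ℂ B, (x : V) ∈ Submodule.span ℍ[ℝ]
        (Set.range fun b : B => ((b : complexPart hc I) : V)) from h _ hmem
    intro x hx
    induction hx using Submodule.span_induction with
    | mem x hx => exact Submodule.subset_span ⟨⟨x, hx⟩, rfl⟩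
    | zero => exact Submodule.zero_mem _
    | add x y _ _ hx hy => exact Submodule.add_mem _ hx hy
    | smul z x _ hx =>
      rw [Submodule.coe_smul, hc]
      exact Submodule.smul_mem _ _ hx
  let b := Module.Basis.mk hli hsp
  have hb : ∀ i, b i = ((i : complexPart hc I) : V) := fun i => Module.Basis.mk_apply hli hsp i
  refine ⟨_, b.reindexRange, ?_, ?_⟩
  · rintro ⟨_, i, rfl⟩
    rw [Module.Basis.reindexRange_self, hb]
    exact i.1.2
  · rintro ⟨_, i, rfl⟩
    rw [Module.Basis.reindexRange_self, hb]
    refine (hB.map_mem i i.2).imp (fun h => congrArg Subtype.val h) fun h => ⟨⟨_, ⟨_, h⟩, rfl⟩, ?_⟩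
    rw [Module.Basis.reindexRange_self, hb]
    rfl

end ComplexStructure

/-- On the adapted basis `I` is the scalar `i` and `s` is `±q`, so commuting `s` past `I` reduces to
commuting `q` past `i`. Used for `q = j`, `δ = -1` and for `q = i`, `δ = 1`. -/
theorem exists_anticommute_of_complex_structure {V : Type*} [AddCommGroup V] [Module ℍ[ℝ] V]
    {I N : Module.End ℍ[ℝ] V} (hI : I * I = -1) (hN : IsNilpotent N) (hIN : Commute I N)
    {q : ℍ[ℝ]} (hq : q * q = -1) {δ : ℤ} (hqI : quatI * q = δ • (q * quatI)) :
    ∃ s : Module.End ℍ[ℝ] V, s * s = -1 ∧ s * N = -(N * s) ∧ s * I = δ • (I * s) := by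
  let : Module ℂ V := Module.compHom V (Quaternion.ofComplex : ℂ →ₐ[ℝ] ℍ[ℝ]).toRingHom
  obtain ⟨ι, b, hbI, hbN⟩ := exists_basis_of_complex_structure (fun _ _ => rfl) hI hN hIN
  obtain ⟨s, h1, h2, h3⟩ := exists_anticommute_of_basis hN b hbN hq
  refine ⟨s, h1, h2, b.ext fun i => ?_⟩
  rw [LinearMap.smul_apply, Module.End.mul_apply, Module.End.mul_apply, hbI, map_smul]
  rcases h3 i with h | h <;>
    simp only [h, map_neg, map_smul, hbI, smul_neg, smul_smul, hqI, smul_assoc]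

/-! ### Correcting intertwiners, and Cayley transforms -/

section Intertwiners

/-- `g` and `k` are intertwined by a square root of `-1`. -/
def SkewIntertwined {A : Type*} [Ring A] (g k : A) : Prop := ∃ s : A, s * s = -1 ∧ s * g = k * s

/-- An invertible intertwiner of `g` and `k` that swaps two complementary idempotents commuting with
`g` can be turned into one whose square is `-1`. -/
theorem skewIntertwined_of_swap {A : Type*} [Ring A] {g k h h' e : A} (hh' : h * h' = 1)
    (hh : h' * h = 1) (hg : h * g = k * h) (hk : h * k = g * h) (he : e * e = e)
    (heg : Commute e g) (hhe : h * e = (1 - e) * h) : SkewIntertwined g k := by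
  have h'e : h' * (1 - e) = e * h' := by
    calc h' * (1 - e) = h' * ((1 - e) * h) * h' := by simp only [mul_assoc, hh', mul_one]
      _ = e * h' := by rw [← hhe, ← mul_assoc h', hh, one_mul]
  have h'g : h' * g = k * h' := by
    calc h' * g = h' * (g * h) * h' := by simp only [mul_assoc, hh', mul_one]
      _ = k * h' := by rw [← hk, ← mul_assoc h', hh, one_mul]
  have e1 : e * (1 - e) = 0 := by rw [mul_sub, mul_one, he, sub_self]
  have e2 : (1 - e) * e = 0 := by rw [sub_mul, one_mul, he, sub_self]
  have e3 : (1 - e) * (1 - e) = 1 - e := by rw [mul_sub, e2, mul_one, sub_zero]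
  have p1 : h * e * (h * e) = 0 := by
    rw [mul_assoc h e, ← mul_assoc e h, mul_assoc e h e, hhe, ← mul_assoc e, e1, zero_mul, mul_zero]
  have p2 : h * e * (h' * (1 - e)) = 1 - e := by
    rw [h'e, mul_assoc h e, ← mul_assoc e e, he, ← mul_assoc, hhe, mul_assoc, hh', mul_one]
  have p3 : h' * (1 - e) * (h * e) = e := by
    rw [hhe, mul_assoc h', ← mul_assoc (1 - e), e3, ← mul_assoc, h'e, mul_assoc, hh, mul_one]
  have p4 : h' * (1 - e) * (h' * (1 - e)) = 0 := by
    rw [mul_assoc h', ← mul_assoc (1 - e) h', mul_assoc (1 - e) h', h'e, ← mul_assoc (1 - e), e2,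
      zero_mul, mul_zero]
  -- Use `h` from the first component to the second and `-h⁻¹` on the way back; both diagonal blocks
  -- of the square are then `-1`.
  refine ⟨h * e - h' * (1 - e), ?_, ?_⟩
  · rw [mul_sub, sub_mul, sub_mul, p1, p2, p3, p4]
    abel
  · have heg' : Commute (1 - e) g := (Commute.one_left g).sub_left heg
    rw [sub_mul, mul_assoc, heg.eq, mul_assoc, heg'.eq, ← mul_assoc, ← mul_assoc, hg, h'g,
      mul_sub k, mul_assoc, mul_assoc]

variable {A : Type*} [Ring A] [Algebra ℝ A]

/-- If `g` is the inverse Cayley transform of a nilpotent `N` scaled by `S`, an element which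
anticommutes with `N` and intertwines `S` with `ε S⁻¹` intertwines `g` with `ε g⁻¹`. -/
theorem mul_eq_mul_of_cayley {g k S T N s : A} {ε : ℝ} (hε : ε ≠ 0) (hkg : k * g = ε • 1)
    (hST : S * T = ε • 1) (hTN : Commute T N) (hN : IsNilpotent N)
    (hgN : g * (1 - N) = S * (1 + N)) (hsS : s * S = T * s) (hsN : s * N = -(N * s)) :
    s * g = k * s := by
  have hT1 : Commute T (1 - N) := (Commute.one_right T).sub_right hTN
  have hT2 : Commute T (1 + N) := (Commute.one_right T).add_right hTN
  -- `T` plays the role of `ε S⁻¹`, so `k = T (1 - N) (1 + N)⁻¹`: the transform of `g` with `N`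
  -- negated.
  have hk : k * (1 + N) = T * (1 - N) := by
    have h1 : ε • (1 - N) = k * (S * (1 + N)) := by
      rw [← hgN, ← mul_assoc, hkg, smul_mul_assoc, one_mul]
    have h2 : ε • (T * (1 - N)) = ε • (k * (1 + N)) := by
      rw [hT1.eq, ← smul_mul_assoc, h1, mul_assoc, mul_assoc, ← hT2.eq, ← mul_assoc S, hST,
        smul_mul_assoc, one_mul, mul_smul_comm]
    exact (smul_right_injective A hε h2).symm
  have hs1 : s * (1 + N) = (1 - N) * s := by
    rw [mul_add, mul_one, hsN, sub_mul, one_mul, sub_eq_add_neg]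
  have hs2 : s * (1 - N) = (1 + N) * s := by
    rw [mul_sub, mul_one, hsN, add_mul, one_mul, sub_neg_eq_add]
  have hu : IsUnit (1 - N) := hN.isUnit_one_sub
  apply hu.mul_left_injective
  change s * g * (1 - N) = k * s * (1 - N)
  rw [mul_assoc, hgN, ← mul_assoc, hsS, mul_assoc, hs1, ← mul_assoc, ← hk, mul_assoc, ← hs2,
    mul_assoc]

/-- Solving for `N` gives `(g - S) / (g + S)`, and `g + S = 2 S + (g - S)` is a unit plus a
nilpotent. -/
theorem exists_cayley {R : Type*} [CommRing R] [Algebra ℝ R] {g S : R} (h : IsNilpotent (g - S))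
    (hS : IsUnit S) : ∃ N : R, IsNilpotent N ∧ g * (1 - N) = S * (1 + N) := by
  have h2S : IsUnit (2 * S) := by
    refine IsUnit.mul ?_ hS
    have := (isUnit_iff_ne_zero.2 (two_ne_zero : (2 : ℝ) ≠ 0)).map (algebraMap ℝ R)
    rwa [map_ofNat] at this
  have hgS : IsUnit (g + S) := by
    have := h.isUnit_add_left_of_commute h2S (Commute.all _ _)
    rwa [show 2 * S + (g - S) = g + S by ring] at this
  obtain ⟨u, hu⟩ := hgS.exists_right_inv
  refine ⟨(g - S) * u, (Commute.all _ _).isNilpotent_mul_right h, ?_⟩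
  linear_combination (S - g) * hu

/-- An element killed up to nilpotents by `X ^ 2 - t X + 1`, where `t ^ 2 < 4`, is a unipotent
multiple of a point of a unit circle. -/
theorem exists_cayley_of_quadratic {R : Type*} [CommRing R] [Algebra ℝ R] {g : R} {t r : ℝ}
    (hr : r ≠ 0) (htr : t ^ 2 + r ^ 2 = 1)
    (h : IsNilpotent (g ^ 2 - algebraMap ℝ R (2 * t) * g + 1)) :
    ∃ I N : R, I * I = -1 ∧ IsNilpotent N ∧
      g * (1 - N) = (algebraMap ℝ R t + algebraMap ℝ R r * I) * (1 + N) := by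
  let P : Polynomial ℝ := Polynomial.X ^ 2 - Polynomial.C (2 * t) * Polynomial.X + 1
  have hP : Polynomial.aeval g P = g ^ 2 - algebraMap ℝ R (2 * t) * g + 1 := by
    simp [P, Polynomial.aeval_def]
  have hP' : Polynomial.aeval g P.derivative = 2 * g - algebraMap ℝ R (2 * t) := by
    simp [P, Polynomial.aeval_def, one_add_one_eq_two]
    rw [map_ofNat]
  have hcomb : algebraMap ℝ R t ^ 2 + algebraMap ℝ R r ^ 2 = 1 := by
    rw [← map_pow, ← map_pow, ← map_add, htr, map_one]
  have h2t : algebraMap ℝ R (2 * t) = 2 * algebraMap ℝ R t := by rw [map_mul, map_ofNat]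
  have hrinv : algebraMap ℝ R r * algebraMap ℝ R r⁻¹ = 1 := by
    rw [← map_mul, mul_inv_cancel₀ hr, map_one]
  -- For `P = X ^ 2 - 2 t X + 1` one has `P' ^ 2 = 4 P - 4 r ^ 2`, so `P'(g)` is a unit because
  -- `P(g)` is nilpotent.
  have hunit : IsUnit (2 * g - algebraMap ℝ R (2 * t)) := by
    have h1 : IsUnit (algebraMap ℝ R (-4 * r ^ 2)) :=
      (isUnit_iff_ne_zero.2 (by simp [hr])).map (algebraMap ℝ R)
    have h2 := ((Commute.all _ (4 : R)).isNilpotent_mul_right h).isUnit_add_left_of_commute h1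
      (Commute.all _ _)
    have h3 : algebraMap ℝ R (-4 * r ^ 2) + (g ^ 2 - algebraMap ℝ R (2 * t) * g + 1) * 4 =
        (2 * g - algebraMap ℝ R (2 * t)) * (2 * g - algebraMap ℝ R (2 * t)) := by
      rw [h2t]
      simp only [map_mul, map_neg, map_pow, map_ofNat]
      linear_combination -4 * hcomb
    exact isUnit_of_mul_isUnit_left (h3 ▸ h2)
  -- Newton iteration corrects `g` by a nilpotent to an exact root `S` of `P`; then `(S - t) ^ 2 =
  -- -r ^ 2`, so `(S - t) / r` is the complex structure.
  obtain ⟨S, ⟨hS1, hS2⟩, -⟩ := Polynomial.existsUnique_nilpotent_sub_and_aeval_eq_zero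
    (P := P) (x := g) (hP ▸ h) (hP' ▸ hunit)
  have hS3 : S ^ 2 - 2 * algebraMap ℝ R t * S + 1 = 0 := by
    rw [← hS2, ← h2t]
    simp [P, Polynomial.aeval_def]
  have hSu : IsUnit S := IsUnit.of_mul_eq_one (2 * algebraMap ℝ R t - S) (by linear_combination -hS3)
  obtain ⟨N, hN, hgN⟩ := exists_cayley hS1 hSu
  refine ⟨algebraMap ℝ R r⁻¹ * (S - algebraMap ℝ R t), N, ?_, hN, ?_⟩
  · have h5 : algebraMap ℝ R r⁻¹ ^ 2 * algebraMap ℝ R r ^ 2 = 1 := by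
      rw [← mul_pow, mul_comm, hrinv, one_pow]
    linear_combination algebraMap ℝ R r⁻¹ ^ 2 * (hS3 - hcomb) - h5 +
      2 * algebraMap ℝ R r⁻¹ ^ 2 * hcomb
  · rw [hgN]
    linear_combination (-(S - algebraMap ℝ R t) * (1 + N)) * hrinv

end Intertwiners

/-! ### The self-reciprocal primary components -/

section NilpotentCases

variable {V : Type*} [AddCommGroup V] [Module ℍ[ℝ] V] [Module ℝ V] [IsScalarTower ℝ ℍ[ℝ] V]

open scoped IsMulCommutative in
-- The commutative case applies inside `ℝ[g]`.
theorem exists_cayley_of_isNilpotent_sub {A : Type*} [Ring A] [Algebra ℝ A] {g : A} {r : ℝ}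
    (hr : r ≠ 0) (h : IsNilpotent (g - algebraMap ℝ A r)) :
    ∃ N : A, IsNilpotent N ∧ g * (1 - N) = algebraMap ℝ A r * (1 + N) := by
  let R := Algebra.adjoin ℝ {g}
  let γ : R := ⟨g, Algebra.self_mem_adjoin_singleton ℝ g⟩
  have h' : IsNilpotent (γ - algebraMap ℝ R r) :=
    (IsNilpotent.map_iff (f := R.val) Subtype.val_injective).1 h
  obtain ⟨N, hN, hgN⟩ := exists_cayley h' ((isUnit_iff_ne_zero.2 hr).map (algebraMap ℝ R))
  exact ⟨N, hN.map R.val, congrArg R.val hgN⟩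

open scoped IsMulCommutative in
theorem exists_commute_cayley_of_quadratic {A : Type*} [Ring A] [Algebra ℝ A] {g : A} {t r : ℝ}
    (hr : r ≠ 0) (htr : t ^ 2 + r ^ 2 = 1)
    (h : IsNilpotent (g ^ 2 - algebraMap ℝ A (2 * t) * g + 1)) :
    ∃ I N : A, I * I = -1 ∧ IsNilpotent N ∧ Commute I N ∧
      g * (1 - N) = (algebraMap ℝ A t + algebraMap ℝ A r * I) * (1 + N) := by
  let R := Algebra.adjoin ℝ {g}
  let γ : R := ⟨g, Algebra.self_mem_adjoin_singleton ℝ g⟩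
  have h' : IsNilpotent (γ ^ 2 - algebraMap ℝ R (2 * t) * γ + 1) :=
    (IsNilpotent.map_iff (f := R.val) Subtype.val_injective).1 h
  obtain ⟨I, N, hI, hN, hgN⟩ := exists_cayley_of_quadratic hr htr h'
  exact ⟨I, N, congrArg R.val hI, hN.map R.val, congrArg R.val (mul_comm I N), congrArg R.val hgN⟩

theorem skewIntertwined_of_isNilpotent_sub {g k : Module.End ℍ[ℝ] V} (hkg : k * g = 1) {r : ℝ}
    (hr : r * r = 1) (h : IsNilpotent (g - algebraMap ℝ _ r)) : SkewIntertwined g k := by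
  obtain ⟨N, hN, hgN⟩ := exists_cayley_of_isNilpotent_sub
    (fun h0 => by simp [h0] at hr : r ≠ 0) h
  obtain ⟨s, hs, hsN⟩ := exists_anticommute_of_isNilpotent hN quatI_mul_self
  refine ⟨s, hs, mul_eq_mul_of_cayley (T := algebraMap ℝ _ r) (ε := 1) one_ne_zero
    (by rw [hkg, one_smul]) (by rw [← map_mul, hr, map_one, one_smul]) (Algebra.commutes r N) hN
    hgN (Algebra.commutes r s).symm hsN⟩

/-- Here `S = t + r I` has inverse `t - r I`, so `s` must anticommute with `I`: take `q = j`. -/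
theorem skewIntertwined_of_isNilpotent_quadratic {g k : Module.End ℍ[ℝ] V} (hkg : k * g = 1)
    {t r : ℝ} (hr : r ≠ 0) (htr : t ^ 2 + r ^ 2 = 1)
    (h : IsNilpotent (g ^ 2 - algebraMap ℝ _ (2 * t) * g + 1)) : SkewIntertwined g k := by
  obtain ⟨I, N, hI, hN, hIN, hgN⟩ := exists_commute_cayley_of_quadratic hr htr h
  obtain ⟨s, hs, hsN, hsI⟩ := exists_anticommute_of_complex_structure hI hN hIN quatJ_mul_self
    (δ := -1) (by rw [quatJ_mul_quatI, neg_one_smul, neg_neg])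
  rw [neg_one_smul] at hsI
  refine ⟨s, hs, mul_eq_mul_of_cayley (T := algebraMap ℝ _ t - algebraMap ℝ _ r * I) (ε := 1)
    one_ne_zero (by rw [hkg, one_smul]) ?_ ?_ hN hgN ?_ hsN⟩
  · have h1 : algebraMap ℝ (Module.End ℍ[ℝ] V) (t ^ 2 + r ^ 2) = 1 := by rw [htr, map_one]
    rw [map_add, map_pow, map_pow] at h1
    rw [one_smul, ← h1]
    have hrI := Algebra.commutes r I
    have h2 : algebraMap ℝ (Module.End ℍ[ℝ] V) r * I * (algebraMap ℝ _ r * I) =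
        -(algebraMap ℝ _ r) ^ 2 := by
      rw [mul_assoc, ← mul_assoc I, ← hrI, mul_assoc, hI, ← mul_assoc, mul_neg, mul_one, pow_two]
    have h3 : algebraMap ℝ (Module.End ℍ[ℝ] V) r * I * algebraMap ℝ _ t =
        algebraMap ℝ _ t * (algebraMap ℝ _ r * I) := by
      rw [Algebra.commutes t]
    rw [add_mul, mul_sub, mul_sub, h2, h3]
    simp only [pow_two]
    abel
  · exact Commute.sub_left (Algebra.commutes t N) (Commute.mul_left (Algebra.commutes r N) hIN)
  · rw [mul_add, sub_mul, ← Algebra.commutes t s, ← mul_assoc, ← Algebra.commutes r s, mul_assoc,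
      hsI, mul_neg, mul_assoc, sub_eq_add_neg]

/-- With `ε = -1` and `S = I`, `ε S⁻¹` is `I` again, so `s` must commute with `I`: take `q = i`. -/
theorem skewIntertwined_of_isNilpotent_sq_add_one {g k : Module.End ℍ[ℝ] V} (hkg : k * g = -1)
    (h : IsNilpotent (g ^ 2 + 1)) : SkewIntertwined g k := by
  obtain ⟨I, N, hI, hN, hIN, hgN⟩ := exists_commute_cayley_of_quadratic (g := g) (t := 0) (r := 1)
    one_ne_zero (by norm_num) (by simpa using h)
  simp only [map_zero, map_one, one_mul, zero_add] at hgN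
  obtain ⟨s, hs, hsN, hsI⟩ := exists_anticommute_of_complex_structure hI hN hIN quatI_mul_self
    (δ := 1) (by rw [one_smul])
  rw [one_smul] at hsI
  exact ⟨s, hs, mul_eq_mul_of_cayley (T := I) (ε := -1) (by norm_num) (by rw [hkg, neg_one_smul])
    (by rw [hI, neg_one_smul]) hIN hN hgN hsI hsN⟩

end NilpotentCases

/-! ### Polynomials in `g` and `k`; swapped components -/

section Polynomial

theorem semiconj_aeval {V W : Type*} [AddCommGroup V] [Module ℍ[ℝ] V] [Module ℝ V]
    [IsScalarTower ℝ ℍ[ℝ] V] [AddCommGroup W] [Module ℍ[ℝ] W] [Module ℝ W]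
    [IsScalarTower ℝ ℍ[ℝ] W] {g : Module.End ℍ[ℝ] V} {k : Module.End ℍ[ℝ] W} {h : V →ₗ[ℍ[ℝ]] W}
    (hgk : ∀ v, h (g v) = k (h v)) (p : Polynomial ℝ) (v : V) :
    h (Polynomial.aeval g p v) = Polynomial.aeval k p (h v) := by
  induction p using Polynomial.induction_on' generalizing v with
  | add p q hp hq => simp [hp, hq]
  | monomial n c =>
    rw [Polynomial.aeval_monomial, Polynomial.aeval_monomial]
    simp only [Module.End.mul_apply, Module.algebraMap_end_apply]
    have hc : ∀ w, h (c • w) = c • h w := fun w => by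
      rw [← smul_one_smul ℍ[ℝ] c w, map_smul, smul_one_smul]
    rw [hc]
    congr 1
    induction n generalizing v with
    | zero => rfl
    | succ n ih => rw [pow_succ, pow_succ, Module.End.mul_apply, Module.End.mul_apply, ih, hgk]

theorem commute_aeval_right {A : Type*} [Ring A] [Algebra ℝ A] {x g : A} (h : Commute x g)
    (p : Polynomial ℝ) : Commute x (Polynomial.aeval g p) := by
  induction p using Polynomial.induction_on' with
  | add p q hp hq => rw [map_add]; exact hp.add_right hq
  | monomial n c =>
    rw [Polynomial.aeval_monomial]
    exact Commute.mul_right (Algebra.commutes c x).symm (h.pow_right n)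

/-- If `p` is coprime to the polynomial describing `p (ε / g)`, then `h` swaps the two primary
components. -/
theorem skewIntertwined_of_isCoprime {A : Type*} [Ring A] [Algebra ℝ A] {g k h h' : A}
    (hh' : h * h' = 1) (hh : h' * h = 1) (hgk' : Commute g k)
    (hg : ∀ p : Polynomial ℝ, h * Polynomial.aeval g p = Polynomial.aeval k p * h)
    (hk : ∀ p : Polynomial ℝ, h * Polynomial.aeval k p = Polynomial.aeval g p * h)
    {p q : Polynomial ℝ} {m : ℕ} (hpq : IsCoprime p q)
    (hq : Polynomial.aeval g q = g ^ m * Polynomial.aeval k p)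
    (hnil : IsNilpotent (Polynomial.aeval g p * Polynomial.aeval k p)) : SkewIntertwined g k := by
  have hcomm : ∀ x y : Polynomial ℝ, Commute (Polynomial.aeval g x) (Polynomial.aeval k y) :=
    fun x y => commute_aeval_right (commute_aeval_right hgk'.symm x).symm y
  obtain ⟨n, hn⟩ := hnil
  rw [(hcomm p p).mul_pow] at hn
  -- The Bézout term `w q ^ n`, evaluated at `g`, is the projection `e` onto the kernel of `p(g) ^
  -- n` along that of `p(k) ^ n`. Evaluated at `k` it is the conjugate `e₁` of `e` by `h`, and must
  -- be `1 - e`.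
  obtain ⟨u, w, huw⟩ := hpq.pow (m := n) (n := n)
  have hX : g ^ m = Polynomial.aeval g (Polynomial.X ^ m : Polynomial ℝ) := by simp
  have hqn : Polynomial.aeval g q ^ n = (g ^ m) ^ n * Polynomial.aeval k p ^ n := by
    rw [hq, Commute.mul_pow]
    rw [hX]
    exact hcomm _ _
  have hqn' : Polynomial.aeval g (w * q ^ n) = Polynomial.aeval g w * (g ^ m) ^ n *
      Polynomial.aeval k p ^ n := by
    rw [map_mul, map_pow, hqn, mul_assoc]
  set a := Polynomial.aeval g p with ha
  set b := Polynomial.aeval k p with hb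
  set e := Polynomial.aeval g (w * q ^ n) with he
  set e₁ := Polynomial.aeval k (w * q ^ n) with he₁
  have h1e : 1 - e = Polynomial.aeval g (u * p ^ n) := by
    rw [he, sub_eq_iff_eq_add, ← map_add, huw, map_one]
  have hea : e * a ^ n = 0 := by
    rw [hqn', mul_assoc, ← ((hcomm p p).pow_pow n n).eq, hn, mul_zero]
  have heb : (1 - e) * b ^ n = 0 := by
    rw [h1e, map_mul, map_pow, mul_assoc, hn, mul_zero]
  have hcan : ∀ x, x * h = 0 → x = 0 := fun x hx => by
    rw [← mul_one x, ← hh', ← mul_assoc, hx, zero_mul]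
  have h1 : e₁ * b ^ n = 0 := by
    apply hcan
    rw [← map_pow, mul_assoc, ← hg, map_pow, ← mul_assoc, ← hg, mul_assoc, hea, mul_zero]
  have h2 : (1 - e₁) * a ^ n = 0 := by
    apply hcan
    rw [← map_pow, mul_assoc, ← hk, map_pow, ← mul_assoc, sub_mul, one_mul, ← hg, ← mul_one_sub,
      mul_assoc, heb, mul_zero]
  have h3 : e * e₁ = 0 := by
    have hb : b ^ n * e₁ = e₁ * b ^ n := by
      rw [← map_pow, ← map_mul, ← map_mul, mul_comm]
    rw [hqn', mul_assoc, hb, h1, mul_zero]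
  have h4 : (1 - e) * (1 - e₁) = 0 := by
    have ha : a ^ n * (1 - e₁) = (1 - e₁) * a ^ n := by
      rw [← map_pow, mul_sub, sub_mul, (hcomm _ _).eq, mul_one, one_mul]
    rw [h1e, map_mul, map_pow, mul_assoc, ha, h2, mul_zero]
  have h5 : e₁ = 1 - e := by
    rw [mul_sub, mul_one, sub_mul, one_mul, h3, sub_zero, sub_eq_zero] at h4
    exact h4.symm
  have hee : e * e = e := by
    have h6 : e * (1 - e) = 0 := by
      rw [h1e, mul_comm u, map_mul, map_pow, ← mul_assoc, hea, zero_mul]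
    rw [mul_sub, mul_one, sub_eq_zero] at h6
    exact h6.symm
  refine skewIntertwined_of_swap hh' hh (by simpa using hg Polynomial.X)
    (by simpa using hk Polynomial.X) hee (commute_aeval_right (Commute.refl g) _).symm ?_
  rw [he, hg, ← h5]

end Polynomial

theorem skewIntertwined_of_isCompl {V : Type*} [AddCommGroup V] [Module ℍ[ℝ] V]
    {g k : Module.End ℍ[ℝ] V} {W₁ W₂ : Submodule ℍ[ℝ] V} (hW : IsCompl W₁ W₂)
    {g₁ k₁ : Module.End ℍ[ℝ] W₁} {g₂ k₂ : Module.End ℍ[ℝ] W₂}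
    (hg₁ : ∀ x, (g₁ x : V) = g x) (hk₁ : ∀ x, (k₁ x : V) = k x)
    (hg₂ : ∀ x, (g₂ x : V) = g x) (hk₂ : ∀ x, (k₂ x : V) = k x)
    (h₁ : SkewIntertwined g₁ k₁) (h₂ : SkewIntertwined g₂ k₂) : SkewIntertwined g k := by
  obtain ⟨s₁, hs₁, hsg₁⟩ := h₁
  obtain ⟨s₂, hs₂, hsg₂⟩ := h₂
  let φ := Submodule.prodEquivOfIsCompl W₁ W₂ hW
  let s : Module.End ℍ[ℝ] V := φ.toLinearMap ∘ₗ (s₁.prodMap s₂) ∘ₗ φ.symm.toLinearMap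
  have hs : ∀ (x : W₁) (y : W₂), s (x + y) = s₁ x + s₂ y := by
    intro x y
    have h : φ.symm ((x : V) + y) = (x, y) := by
      rw [LinearEquiv.symm_apply_eq]
      simp [φ]
    change φ ((s₁.prodMap s₂) (φ.symm ((x : V) + y))) = _
    rw [h]
    simp [φ]
  have hdec : ∀ v : V, ∃ (x : W₁) (y : W₂), v = x + y := fun v =>
    ⟨(φ.symm v).1, (φ.symm v).2, by
      conv_lhs => rw [← φ.apply_symm_apply v]
      simp only [φ, Submodule.coe_prodEquivOfIsCompl']⟩
  have hss₁ : ∀ x, s₁ (s₁ x) = -x := fun x => LinearMap.congr_fun hs₁ x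
  have hss₂ : ∀ x, s₂ (s₂ x) = -x := fun x => LinearMap.congr_fun hs₂ x
  have hsgx₁ : ∀ x, s₁ (g₁ x) = k₁ (s₁ x) := fun x => LinearMap.congr_fun hsg₁ x
  have hsgx₂ : ∀ x, s₂ (g₂ x) = k₂ (s₂ x) := fun x => LinearMap.congr_fun hsg₂ x
  refine ⟨s, LinearMap.ext fun v => ?_, LinearMap.ext fun v => ?_⟩
  · obtain ⟨x, y, rfl⟩ := hdec v
    rw [Module.End.mul_apply, hs, hs, hss₁, hss₂]
    simp [add_comm]
  · obtain ⟨x, y, rfl⟩ := hdec v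
    rw [Module.End.mul_apply, Module.End.mul_apply, hs, map_add g, map_add k, ← hg₁, ← hg₂, hs,
      hsgx₁, hsgx₂, hk₁, hk₂]

/-- If `p` is its own reciprocal up to a scalar, `g ^ m p(g) p(k)` is a nonzero multiple of `p(g) ^
2`. -/
theorem isNilpotent_aeval_of_smul {A : Type*} [Ring A] [Algebra ℝ A] {g k : A}
    (hgk : Commute g k) {p : Polynomial ℝ} {m : ℕ} {c : ℝ} (hc : c ≠ 0)
    (hq : g ^ m * Polynomial.aeval k p = c • Polynomial.aeval g p)
    (hnil : IsNilpotent (Polynomial.aeval g p * Polynomial.aeval k p)) :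
    IsNilpotent (Polynomial.aeval g p) := by
  have h1 : Commute g (Polynomial.aeval g p) := commute_aeval_right (Commute.refl g) p
  have h2 : Commute g (Polynomial.aeval k p) := commute_aeval_right hgk p
  have h3 : IsNilpotent (g ^ m * (Polynomial.aeval g p * Polynomial.aeval k p)) :=
    ((h1.mul_right h2).pow_left m).isNilpotent_mul_left hnil
  have h4 : g ^ m * (Polynomial.aeval g p * Polynomial.aeval k p) =
      c • (Polynomial.aeval g p) ^ 2 := by
    rw [← mul_assoc, (h1.pow_left m).eq, mul_assoc, hq, mul_smul_comm, pow_two]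
  have h5 : IsNilpotent (Polynomial.aeval g p ^ 2) := by
    have h6 := (h4 ▸ h3).smul c⁻¹
    rwa [smul_smul, inv_mul_cancel₀ hc, one_smul] at h6
  exact (IsNilpotent.pow_iff_pos two_ne_zero).1 h5

theorem discrim_neg_of_irreducible {b d : ℝ}
    (h : Irreducible (Polynomial.X ^ 2 + Polynomial.C b * Polynomial.X + Polynomial.C d)) :
    b ^ 2 < 4 * d := by
  by_contra! hle
  have hdeg : (Polynomial.X ^ 2 + Polynomial.C b * Polynomial.X + Polynomial.C d).degree = 2 := by
    compute_degree!
  have hroot : (Polynomial.X ^ 2 + Polynomial.C b * Polynomial.X + Polynomial.C d).IsRoot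
      ((-b + Real.sqrt (b ^ 2 - 4 * d)) / 2) := by
    have := Real.sq_sqrt (sub_nonneg.2 hle)
    simp only [Polynomial.IsRoot.def, Polynomial.eval_add, Polynomial.eval_pow, Polynomial.eval_X,
      Polynomial.eval_mul, Polynomial.eval_C]
    linear_combination this / 4
  have := Polynomial.degree_eq_one_of_irreducible_of_root h hroot
  rw [hdeg] at this
  norm_num at this

/-! ### Irreducible factors of degree one and two -/

section Main

variable {V : Type*} [AddCommGroup V] [Module ℍ[ℝ] V] [Module ℝ V] [IsScalarTower ℝ ℍ[ℝ] V]

/-- The reciprocal of `X + c` is `c X + ε`. Failure of coprimality forces `c ^ 2 = ε`, hence `ε = 1`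
and `c = ±1`. -/
theorem skewIntertwined_of_isNilpotent_linear {g k h h' : Module.End ℍ[ℝ] V} {ε c : ℝ}
    (hε : ε = 1 ∨ ε = -1) (hgk : g * k = ε • 1) (hkg : k * g = ε • 1) (hh' : h * h' = 1)
    (hh : h' * h = 1)
    (hg : ∀ p : Polynomial ℝ, h * Polynomial.aeval g p = Polynomial.aeval k p * h)
    (hk : ∀ p : Polynomial ℝ, h * Polynomial.aeval k p = Polynomial.aeval g p * h)
    (hp : Irreducible (Polynomial.X + Polynomial.C c))
    (hnil : IsNilpotent (Polynomial.aeval g (Polynomial.X + Polynomial.C c) *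
      Polynomial.aeval k (Polynomial.X + Polynomial.C c))) : SkewIntertwined g k := by
  have hcomm : Commute g k := hgk.trans hkg.symm
  by_cases hcop : IsCoprime (Polynomial.X + Polynomial.C c)
      (Polynomial.C c * Polynomial.X + Polynomial.C ε)
  · refine skewIntertwined_of_isCoprime (m := 1) hh' hh hcomm hg hk hcop ?_ hnil
    simp only [map_add, map_mul, Polynomial.aeval_X, Polynomial.aeval_C, pow_one, mul_add, hgk,
      Algebra.algebraMap_eq_smul_one, mul_smul_comm, smul_mul_assoc, one_mul, mul_one]
    abel
  · rw [hp.coprime_iff_not_dvd, not_not] at hcop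
    have hε' : ε = c * c := by
      have h0 : Polynomial.eval (-c) (Polynomial.X + Polynomial.C c) = 0 := by simp
      have := Polynomial.eval_eq_zero_of_dvd_of_eval_eq_zero hcop h0
      simp only [Polynomial.eval_add, Polynomial.eval_mul, Polynomial.eval_C,
        Polynomial.eval_X] at this
      linarith
    have hε1 : ε = 1 := hε.resolve_right fun h => by nlinarith [mul_self_nonneg c]
    subst hε1
    have ha : IsNilpotent (Polynomial.aeval g (Polynomial.X + Polynomial.C c)) := by
      refine isNilpotent_aeval_of_smul (m := 1) (c := c) hcomm
        (fun h => by simp [h] at hε') ?_ hnil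
      simp only [map_add, Polynomial.aeval_X, Polynomial.aeval_C, pow_one, mul_add, hgk,
        Algebra.algebraMap_eq_smul_one, mul_smul_comm, mul_one, smul_add, smul_smul, ← hε']
      abel
    refine skewIntertwined_of_isNilpotent_sub (r := -c) (by rw [hkg, one_smul]) (by linarith) ?_
    simpa using ha

theorem skewIntertwined_of_isNilpotent_quadratic_mul {g k h h' : Module.End ℍ[ℝ] V} {ε b d : ℝ}
    (hε : ε = 1 ∨ ε = -1) (hgk : g * k = ε • 1) (hkg : k * g = ε • 1) (hh' : h * h' = 1)
    (hh : h' * h = 1)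
    (hg : ∀ p : Polynomial ℝ, h * Polynomial.aeval g p = Polynomial.aeval k p * h)
    (hk : ∀ p : Polynomial ℝ, h * Polynomial.aeval k p = Polynomial.aeval g p * h)
    (hp : Irreducible (Polynomial.X ^ 2 + Polynomial.C b * Polynomial.X + Polynomial.C d))
    (hnil : IsNilpotent
      (Polynomial.aeval g (Polynomial.X ^ 2 + Polynomial.C b * Polynomial.X + Polynomial.C d) *
      Polynomial.aeval k (Polynomial.X ^ 2 + Polynomial.C b * Polynomial.X + Polynomial.C d))) :
    SkewIntertwined g k := by
  have hcomm : Commute g k := hgk.trans hkg.symm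
  have hεε : ε * ε = 1 := by rcases hε with rfl | rfl <;> norm_num
  have hggk : g ^ 2 * k = ε • g := by rw [pow_two, mul_assoc, hgk, mul_smul_comm, mul_one]
  have hggkk : g ^ 2 * k ^ 2 = 1 := by
    rw [← hcomm.mul_pow, hgk, smul_pow, one_pow, pow_two, hεε, one_smul]
  have hq : g ^ 2 * Polynomial.aeval k
      (Polynomial.X ^ 2 + Polynomial.C b * Polynomial.X + Polynomial.C d) =
      d • g ^ 2 + (ε * b) • g + 1 := by
    simp only [map_add, map_mul, map_pow, Polynomial.aeval_X, Polynomial.aeval_C, mul_add, hggk,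
      hggkk, Algebra.algebraMap_eq_smul_one, mul_smul_comm, smul_mul_assoc, one_mul, mul_one,
      smul_smul, mul_comm ε b]
    abel
  have hbd := discrim_neg_of_irreducible hp
  by_cases hcop : IsCoprime (Polynomial.X ^ 2 + Polynomial.C b * Polynomial.X + Polynomial.C d)
      (Polynomial.C d * Polynomial.X ^ 2 + Polynomial.C (ε * b) * Polynomial.X + Polynomial.C 1)
  · refine skewIntertwined_of_isCoprime (m := 2) hh' hh hcomm hg hk hcop ?_ hnil
    rw [hq]
    simp only [map_add, map_mul (Polynomial.aeval g), map_pow, Polynomial.aeval_X,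
      Polynomial.aeval_C, Algebra.algebraMap_eq_smul_one, smul_mul_assoc, one_mul, one_smul]
  · rw [hp.coprime_iff_not_dvd, not_not] at hcop
    obtain ⟨f, hf⟩ := hcop
    have hf0 : f.natDegree = 0 := by
      have h1 : (Polynomial.C d * Polynomial.X ^ 2 + Polynomial.C (ε * b) * Polynomial.X +
        Polynomial.C 1 : Polynomial ℝ).natDegree ≤ 2 := Polynomial.natDegree_quadratic_le
      have hm : (Polynomial.X ^ 2 + Polynomial.C b * Polynomial.X + Polynomial.C d).Monic := by
        monicity!
      have h2 : (Polynomial.X ^ 2 + Polynomial.C b * Polynomial.X + Polynomial.C d).natDegree = 2 := by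
        compute_degree!
      by_cases hf' : f = 0
      · rw [hf', Polynomial.natDegree_zero]
      · rw [hf, hm.natDegree_mul' hf', h2] at h1
        omega
    obtain ⟨c, rfl⟩ := Polynomial.natDegree_eq_zero.1 hf0
    have h0 := congrArg (Polynomial.coeff · 0) hf
    have h1 := congrArg (Polynomial.coeff · 1) hf
    have h2 := congrArg (Polynomial.coeff · 2) hf
    simp [Polynomial.coeff_X, Polynomial.coeff_C, Polynomial.coeff_one] at h0 h1 h2
    -- The reciprocal `d X ^ 2 + ε b X + 1` is `c` times the polynomial, so `c = d` and `d ^ 2 = 1`;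
    -- the negative discriminant excludes `d = -1`.
    have hd : d = 1 := by
      subst h2
      nlinarith [sq_nonneg b]
    subst hd
    have ha : IsNilpotent (Polynomial.aeval g
        (Polynomial.X ^ 2 + Polynomial.C b * Polynomial.X + Polynomial.C 1)) := by
      refine isNilpotent_aeval_of_smul (m := 2) (c := 1) hcomm one_ne_zero ?_ hnil
      have hεb : ε * b = b := by rw [h1, ← h2, mul_one]
      rw [hq, hεb]
      simp only [map_add, map_mul (Polynomial.aeval g), map_pow, Polynomial.aeval_X,
        Polynomial.aeval_C, Algebra.algebraMap_eq_smul_one, smul_mul_assoc, one_mul, one_smul]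
    simp only [map_add, map_mul (Polynomial.aeval g), map_pow, Polynomial.aeval_X,
      Polynomial.aeval_C, map_one] at ha
    rcases hε with rfl | rfl
    · refine skewIntertwined_of_isNilpotent_quadratic (t := -b / 2)
        (r := Real.sqrt (1 - (b / 2) ^ 2)) (by rw [hkg, one_smul])
        (Real.sqrt_ne_zero'.2 (by linarith)) ?_ ?_
      · rw [Real.sq_sqrt (by linarith)]
        ring
      · rw [show 2 * (-b / 2) = -b by ring, map_neg, neg_mul, sub_neg_eq_add]
        exact ha
    · have hb : b = 0 := by
        rw [← h2] at h1
        linarith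
      subst hb
      exact skewIntertwined_of_isNilpotent_sq_add_one (by rw [hkg, neg_one_smul]) (by simpa using ha)

end Main

theorem coe_pow_apply {V : Type*} [AddCommGroup V] [Module ℍ[ℝ] V] {W : Submodule ℍ[ℝ] V} {f : Module.End ℍ[ℝ] V} {f₁ : Module.End ℍ[ℝ] W}
    (h : ∀ v, (f₁ v : V) = f v) (j : ℕ) (v : W) : ((f₁ ^ j) v : V) = (f ^ j) v := by
  induction j generalizing v with
  | zero => rfl
  | succ j ih => rw [pow_succ, pow_succ, Module.End.mul_apply, ih, h, ← Module.End.mul_apply]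

/-! ### Fitting decomposition and induction on dimension -/

section Main

variable {V : Type*} [AddCommGroup V] [Module ℍ[ℝ] V] [Module ℝ V] [IsScalarTower ℝ ℍ[ℝ] V]

theorem skewIntertwined_of_isNilpotent {g k h h' : Module.End ℍ[ℝ] V} {ε : ℝ}
    (hε : ε = 1 ∨ ε = -1) (hgk : g * k = ε • 1) (hkg : k * g = ε • 1) (hh' : h * h' = 1)
    (hh : h' * h = 1) (hg : h * g = k * h) (hk : h * k = g * h)
    {p : Polynomial ℝ} (hmon : p.Monic) (hp : Irreducible p)
    (hnil : IsNilpotent (Polynomial.aeval g p * Polynomial.aeval k p)) : SkewIntertwined g k := by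
  have hg' : ∀ p : Polynomial ℝ, h * Polynomial.aeval g p = Polynomial.aeval k p * h :=
    fun p => LinearMap.ext fun v => semiconj_aeval (fun v => LinearMap.congr_fun hg v) p v
  have hk' : ∀ p : Polynomial ℝ, h * Polynomial.aeval k p = Polynomial.aeval g p * h :=
    fun p => LinearMap.ext fun v => semiconj_aeval (fun v => LinearMap.congr_fun hk v) p v
  have h2 := hp.natDegree_le_two
  have h0 := hp.natDegree_pos
  obtain h1 | h1 : p.natDegree = 1 ∨ p.natDegree = 2 := by omega
  · have hpc := hmon.eq_X_add_C h1
    rw [hpc] at hp hnil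
    exact skewIntertwined_of_isNilpotent_linear hε hgk hkg hh' hh hg' hk' hp hnil
  · have hpc : p = Polynomial.X ^ 2 + Polynomial.C (p.coeff 1) * Polynomial.X +
        Polynomial.C (p.coeff 0) := by
      have := hmon.as_sum
      rw [h1, Finset.sum_range_succ, Finset.sum_range_one, pow_zero, pow_one, mul_one] at this
      rw [add_assoc, add_comm (_ * _)]
      exact this
    rw [hpc] at hp hnil
    exact skewIntertwined_of_isNilpotent_quadratic_mul hε hgk hkg hh' hh hg' hk' hp hnil

/-- Take a factor of the minimal polynomial: were its value a unit, the cofactor would already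
annihilate `g`. -/
theorem exists_monic_irreducible_not_isUnit_aeval {A : Type*} [Ring A] [Algebra ℝ A] [Nontrivial A]
    [Module.Finite ℝ A] (g : A) :
    ∃ p : Polynomial ℝ, p.Monic ∧ Irreducible p ∧ ¬ IsUnit (Polynomial.aeval g p) := by
  have hint : IsIntegral ℝ g := Algebra.IsIntegral.isIntegral g
  obtain ⟨p, hmon, hp, f, hf⟩ := Polynomial.exists_monic_irreducible_factor (minpoly ℝ g)
    (minpoly.not_isUnit ℝ g)
  refine ⟨p, hmon, hp, fun hu => ?_⟩
  have hne : minpoly ℝ g ≠ 0 := minpoly.ne_zero hint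
  have hf0 : f ≠ 0 := fun h => hne (by rw [hf, h, mul_zero])
  have h0 : Polynomial.aeval g f = 0 := by
    have := minpoly.aeval ℝ g
    rw [hf, map_mul] at this
    exact hu.mul_right_eq_zero.1 this
  have hfmon : f.Monic := hmon.of_mul_monic_left (hf ▸ minpoly.monic hint)
  exact minpoly.aeval_ne_zero_of_dvdNotUnit_minpoly hint hfmon ⟨hf0, p, hp.not_isUnit, by rw [hf, mul_comm]⟩ h0

theorem finite_moduleEnd_quaternion [Module.Finite ℍ[ℝ] V] :
    Module.Finite ℝ (Module.End ℍ[ℝ] V) := by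
  have : Module.Finite ℝ V := Module.Finite.trans ℍ[ℝ] V
  exact Module.Finite.of_injective (LinearMap.restrictScalarsₗ ℝ ℍ[ℝ] V V ℝ)
    (LinearMap.restrictScalars_injective ℝ)

end Main

/-- If an invertible quaternionic endomorphism `h` intertwines `g` with `ε g⁻¹`, where `ε = ±1`,
then so does one whose square is `-1`. -/
theorem skewIntertwined_of_intertwined {V : Type*} [AddCommGroup V] [Module ℍ[ℝ] V] [Module ℝ V]
    [IsScalarTower ℝ ℍ[ℝ] V] [Module.Finite ℍ[ℝ] V] {g k h h' : Module.End ℍ[ℝ] V} {ε : ℝ}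
    (hε : ε = 1 ∨ ε = -1) (hgk : g * k = ε • 1) (hkg : k * g = ε • 1) (hh' : h * h' = 1)
    (hh : h' * h = 1) (hg : h * g = k * h) (hk : h * k = g * h) : SkewIntertwined g k := by
  induction hm : Module.finrank ℍ[ℝ] V using Nat.strong_induction_on generalizing V with
  | _ m ih =>
  cases subsingleton_or_nontrivial V with
  | inl hV => exact ⟨1, LinearMap.ext fun _ => Subsingleton.elim _ _,
      LinearMap.ext fun _ => Subsingleton.elim _ _⟩
  | inr hV =>
  have := finite_moduleEnd_quaternion (V := V)
  obtain ⟨p, hmon, hp, hpu⟩ := exists_monic_irreducible_not_isUnit_aeval g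
  have hcomm : Commute g k := hgk.trans hkg.symm
  -- `h` exchanges `p(g)` and `p(k)`, so it is their product that commutes with `g`, `k` and `h` and
  -- has an invariant Fitting decomposition.
  set f := Polynomial.aeval g p * Polynomial.aeval k p with hf
  have hab : Commute (Polynomial.aeval g p) (Polynomial.aeval k p) :=
    commute_aeval_right (commute_aeval_right hcomm.symm p).symm p
  have hfg : Commute f g := ((commute_aeval_right (Commute.refl g) p).mul_right
    (commute_aeval_right hcomm p)).symm
  have hfk : Commute f k := ((commute_aeval_right hcomm.symm p).mul_right
    (commute_aeval_right (Commute.refl k) p)).symm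
  have hfh : Commute f h := by
    have hga : h * Polynomial.aeval g p = Polynomial.aeval k p * h :=
      LinearMap.ext fun v => semiconj_aeval (fun v => LinearMap.congr_fun hg v) p v
    have hka : h * Polynomial.aeval k p = Polynomial.aeval g p * h :=
      LinearMap.ext fun v => semiconj_aeval (fun v => LinearMap.congr_fun hk v) p v
    change f * h = h * f
    rw [hf, ← mul_assoc, hga, mul_assoc _ h, hka, ← mul_assoc, hab.eq]
  have hfh' : Commute f h' := by
    change f * h' = h' * f
    calc f * h' = h' * (h * f) * h' := by rw [← mul_assoc, hh, one_mul]
      _ = h' * f := by rw [← hfh.eq]; simp only [mul_assoc, hh', mul_one]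
  have hfu : ¬ IsUnit f := fun h => hpu (hab.isUnit_mul_iff.1 h).1
  obtain ⟨n, hn, hn0⟩ := ((LinearMap.eventually_isCompl_ker_pow_range_pow f).and
    (Filter.eventually_ne_atTop 0)).exists
  have hker : ∀ x, Commute f x → ∀ v ∈ (f ^ n).ker, x v ∈ (f ^ n).ker := by
    intro x hx v hv
    rw [LinearMap.mem_ker] at hv ⊢
    rw [← Module.End.mul_apply, (hx.pow_left n).eq, Module.End.mul_apply, hv, map_zero]
  have hrange : ∀ x, Commute f x → ∀ v ∈ (f ^ n).range, x v ∈ (f ^ n).range := by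
    rintro x hx _ ⟨w, rfl⟩
    refine ⟨x w, ?_⟩
    rw [← Module.End.mul_apply, (hx.pow_left n).eq, Module.End.mul_apply]
  refine skewIntertwined_of_isCompl hn (g₁ := g.restrict (hker g hfg)) (k₁ := k.restrict (hker k hfk))
    (g₂ := g.restrict (hrange g hfg)) (k₂ := k.restrict (hrange k hfk))
    (fun _ => rfl) (fun _ => rfl) (fun _ => rfl) (fun _ => rfl) ?_ ?_
  · refine skewIntertwined_of_isNilpotent (h := h.restrict (hker h hfh))
      (h' := h'.restrict (hker h' hfh')) hε ?_ ?_ ?_ ?_ ?_ ?_ hmon hp ⟨n, ?_⟩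
    · exact LinearMap.ext fun v => Subtype.ext (LinearMap.congr_fun hgk v)
    · exact LinearMap.ext fun v => Subtype.ext (LinearMap.congr_fun hkg v)
    · exact LinearMap.ext fun v => Subtype.ext (LinearMap.congr_fun hh' v)
    · exact LinearMap.ext fun v => Subtype.ext (LinearMap.congr_fun hh v)
    · exact LinearMap.ext fun v => Subtype.ext (LinearMap.congr_fun hg v)
    · exact LinearMap.ext fun v => Subtype.ext (LinearMap.congr_fun hk v)
    · have hrest : ∀ v, (((Polynomial.aeval (g.restrict (hker g hfg)) p *
          Polynomial.aeval (k.restrict (hker k hfk)) p) v : (f ^ n).ker) : V) = f v := by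
        intro v
        have h1 := semiconj_aeval (h := (f ^ n).ker.subtype) (g := g.restrict (hker g hfg)) (k := g)
          (fun _ => rfl) p
        have h2 := semiconj_aeval (h := (f ^ n).ker.subtype) (g := k.restrict (hker k hfk)) (k := k)
          (fun _ => rfl) p
        simp only [Submodule.subtype_apply] at h1 h2
        rw [Module.End.mul_apply, h1, h2, ← Module.End.mul_apply]
      refine LinearMap.ext fun v => Subtype.ext ?_
      rw [coe_pow_apply hrest]
      exact v.2
  · refine ih _ ?_ (h := h.restrict (hrange h hfh))
      (h' := h'.restrict (hrange h' hfh')) ?_ ?_ ?_ ?_ ?_ ?_ rfl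
    -- The range is proper, as otherwise `f ^ n`, and hence `f` since `n ≠ 0`, would be invertible.
    · rw [← hm]
      apply Submodule.finrank_lt
      intro htop
      have hsurj : Function.Surjective (f ^ n) := LinearMap.range_eq_top.1 htop
      have hu : IsUnit (f ^ n) := (Module.End.isUnit_iff _).2
        (IsNoetherian.bijective_of_surjective_endomorphism _ hsurj)
      exact hfu ((isUnit_pow_iff hn0).1 hu)
    · exact LinearMap.ext fun v => Subtype.ext (LinearMap.congr_fun hgk v)
    · exact LinearMap.ext fun v => Subtype.ext (LinearMap.congr_fun hkg v)
    · exact LinearMap.ext fun v => Subtype.ext (LinearMap.congr_fun hh' v)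
    · exact LinearMap.ext fun v => Subtype.ext (LinearMap.congr_fun hh v)
    · exact LinearMap.ext fun v => Subtype.ext (LinearMap.congr_fun hg v)
    · exact LinearMap.ext fun v => Subtype.ext (LinearMap.congr_fun hk v)

/-! ### Determinants, matrices and the passage to `PSL(n, ℍ)` -/

/-- The embedded matrix is similar, via `J`, to its complex conjugate. -/
theorem star_quatDet (n : ℕ) (A : Matrix (Fin n) (Fin n) ℍ[ℝ]) :
    star (quatDet n A) = quatDet n A := by
  let J : Matrix (Fin n ⊕ Fin n) (Fin n ⊕ Fin n) ℂ := Matrix.fromBlocks 0 1 (-1) 0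
  have hJ : J * J = -1 := by
    simp only [J, Matrix.fromBlocks_multiply, ← Matrix.fromBlocks_one, Matrix.fromBlocks_neg]
    simp
  have hJdet : J.det ≠ 0 := by
    intro h
    have h1 := congrArg Matrix.det hJ
    rw [Matrix.det_mul, h, Matrix.det_neg, Matrix.det_one, Fintype.card_sum,
      Even.neg_one_pow ⟨_, rfl⟩] at h1
    simp at h1
  have hstar : (starRingEnd ℂ).mapMatrix (quatEmbed n A) = Matrix.fromBlocks
      ((A.map quatFst).map star) ((A.map quatSnd).map star) (-(A.map quatSnd)) (A.map quatFst) := by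
    ext (i | i) (j | j) <;> simp [quatEmbed]
  have hcomm : J * (starRingEnd ℂ).mapMatrix (quatEmbed n A) = quatEmbed n A * J := by
    rw [hstar, quatEmbed, Matrix.fromBlocks_multiply, Matrix.fromBlocks_multiply]
    congr 1 <;> ext <;> simp
  have hdet := congrArg Matrix.det hcomm
  rw [Matrix.det_mul, Matrix.det_mul, mul_comm, ← RingHom.map_det] at hdet
  exact mul_right_cancel₀ hJdet hdet

/-- `(1 + S) / √2` is a square root of `S` with real determinant, so `det S ≥ 0`, while `(det S) ^ 2
= det (-1) = 1`. -/
theorem quatDet_eq_one_of_mul_self_eq_neg_one {n : ℕ} {S : Matrix (Fin n) (Fin n) ℍ[ℝ]}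
    (hS : S * S = -1) : quatDet n S = 1 := by
  let t : Matrix (Fin n) (Fin n) ℍ[ℝ] := (Real.sqrt 2)⁻¹ • (1 + S)
  have ht : t * t = S := by
    have h2 : (Real.sqrt 2)⁻¹ * (Real.sqrt 2)⁻¹ * 2 = 1 := by
      rw [← mul_inv, Real.mul_self_sqrt (by norm_num)]
      norm_num
    have h1 : (1 + S) * (1 + S) = (2 : ℝ) • S := by
      rw [mul_add, add_mul, add_mul, hS, two_smul, one_mul, one_mul, mul_one]
      abel
    rw [smul_mul_smul_comm, h1, smul_smul, h2, one_smul]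
  have hd : quatDet n S * quatDet n S = 1 := by
    rw [← map_mul, hS]
    exact neg_one_mem_SLQuat n
  obtain ⟨r, hr⟩ : ∃ r : ℝ, quatDet n t = r :=
    ⟨_, (Complex.conj_eq_iff_re.1 (star_quatDet n t)).symm⟩
  have hSr : quatDet n S = ((r * r : ℝ) : ℂ) := by
    rw [← ht, map_mul, hr, Complex.ofReal_mul]
  rw [hSr] at hd ⊢
  norm_cast at hd ⊢
  nlinarith [mul_self_nonneg r]

/-- If an invertible quaternionic matrix intertwines `G` with `±G⁻¹`, then so does one whose square
is `-1`. -/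
theorem exists_skew_matrix {n : ℕ} {G K C C' : Matrix (Fin n) (Fin n) ℍ[ℝ]} {ε : ℝ}
    (hε : ε = 1 ∨ ε = -1) (hGK : G * K = ε • 1) (hKG : K * G = ε • 1)
    (hCC' : C * C' = 1) (hC'C : C' * C = 1) (hG : C * G = K * C) (hK : C * K = G * C) :
    ∃ S : Matrix (Fin n) (Fin n) ℍ[ℝ], S * S = -1 ∧ S * G = K * S := by
  let T : Matrix (Fin n) (Fin n) ℍ[ℝ] → Module.End ℍ[ℝ] (Fin n → ℍ[ℝ]) :=
    fun M => Matrix.toLinearMapRight' M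
  have hT : ∀ M N, T (M * N) = T N * T M := fun M N => Matrix.toLinearMapRight'_mul M N
  have hT1 : T 1 = 1 := Matrix.toLinearMapRight'_one
  have hTneg : ∀ M, T (-M) = -T M := fun M => map_neg Matrix.toLinearMapRight' M
  have hTε : T (ε • 1) = ε • 1 := by
    rcases hε with rfl | rfl
    · rw [one_smul, one_smul, hT1]
    · rw [neg_one_smul, hTneg, hT1]
      exact (neg_one_smul ℝ (1 : Module.End ℍ[ℝ] (Fin n → ℍ[ℝ]))).symm
  have hTinj : Function.Injective T := Matrix.toLinearMapRight'.injective
  have hG' : G * C' = C' * K := by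
    calc G * C' = C' * (C * G) * C' := by rw [← mul_assoc, hC'C, one_mul]
      _ = C' * K := by rw [hG]; simp only [mul_assoc, hCC', mul_one]
  have hK' : K * C' = C' * G := by
    calc K * C' = C' * (C * K) * C' := by rw [← mul_assoc, hC'C, one_mul]
      _ = C' * G := by rw [hK]; simp only [mul_assoc, hCC', mul_one]
  -- Matrices act on row vectors from the right, which reverses products; hence the intertwiner is
  -- `C⁻¹`.
  obtain ⟨s, hs, hsG⟩ := skewIntertwined_of_intertwined (g := T G) (k := T K) (h := T C')
    (h' := T C) hε (by rw [← hT, hKG, hTε]) (by rw [← hT, hGK, hTε])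
    (by rw [← hT, hCC', hT1]) (by rw [← hT, hC'C, hT1]) (by rw [← hT, ← hT, hG'])
    (by rw [← hT, ← hT, hK'])
  obtain ⟨S, rfl⟩ : ∃ S, T S = s := Matrix.toLinearMapRight'.surjective s
  have hSS : S * S = -1 := hTinj (by rw [hT, hs, hTneg, hT1])
  have hGS : G * S = S * K := hTinj (by rw [hT, hT, hsG])
  refine ⟨S, hSS, ?_⟩
  -- Multiplying by `S` on both sides undoes the reversal, since `S⁻¹ = -S`.
  have h : S * (G * S) * S = S * (S * K) * S := by rw [hGS]
  rw [← mul_assoc S S, hSS, ← mul_assoc, mul_assoc (S * G), hSS] at h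
  simpa using h

theorem exists_eq_smul_of_quotient_eq {n : ℕ} {a b : SLQuat n}
    (h : (a : PSLQuat n) = b) : ∃ ε : ℝ, (ε = 1 ∨ ε = -1) ∧ a.1.1 = ε • b.1.1 := by
  rw [QuotientGroup.eq] at h
  rcases h with h | h
  · refine ⟨1, Or.inl rfl, ?_⟩
    rw [Subgroup.coe_mul, Subgroup.coe_inv, inv_mul_eq_one] at h
    rw [one_smul, h]
  · refine ⟨-1, Or.inr rfl, ?_⟩
    rw [Subgroup.coe_mul, Subgroup.coe_inv, inv_mul_eq_iff_eq_mul] at h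
    rw [h]
    simp

theorem quotient_eq_of_eq_smul {n : ℕ} {a b : SLQuat n} {ε : ℝ} (hε : ε = 1 ∨ ε = -1)
    (h : a.1.1 = ε • b.1.1) : (a : PSLQuat n) = b := by
  rw [QuotientGroup.eq]
  change a.1⁻¹ * b.1 = 1 ∨ a.1⁻¹ * b.1 = -1
  rcases hε with rfl | rfl
  · left
    rw [inv_mul_eq_one]
    exact Units.ext (by rw [h, one_smul])
  · right
    rw [inv_mul_eq_iff_eq_mul]
    exact Units.ext (by simp [h])

theorem theorem1p1 (n : ℕ) (g : PSLQuat n) :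
    IsReversibleElt g ↔ IsStronglyReversibleElt g := by
  refine ⟨fun hrev => ?_, fun ⟨s, _, h⟩ => isConj_iff.2 ⟨s, h⟩⟩
  obtain ⟨c, hc⟩ := isConj_iff.1 hrev
  induction g using QuotientGroup.induction_on with | _ a =>
  induction c using QuotientGroup.induction_on with | _ c =>
  obtain ⟨ε, hε, h⟩ := exists_eq_smul_of_quotient_eq (a := c * a * c⁻¹) (b := a⁻¹) hc
  have hca : c.1.1 * a.1.1 = (ε • a⁻¹.1.1) * c.1.1 := by
    rw [← h]
    change _ = c.1.1 * a.1.1 * c.1⁻¹.1 * c.1.1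
    rw [mul_assoc (c.1.1 * a.1.1), Units.inv_mul, mul_one]
  have haa : a.1.1 * a⁻¹.1.1 = 1 := a.1.mul_inv
  have haa' : a⁻¹.1.1 * a.1.1 = 1 := a.1.inv_mul
  have hca' : c.1.1 * (ε • a⁻¹.1.1) = a.1.1 * c.1.1 := by
    calc c.1.1 * (ε • a⁻¹.1.1) = a.1.1 * ((ε • a⁻¹.1.1) * c.1.1) * a⁻¹.1.1 := by
          rw [smul_mul_assoc, mul_smul_comm, mul_smul_comm, ← mul_assoc, haa, one_mul,
            smul_mul_assoc]
      _ = a.1.1 * c.1.1 := by rw [← hca, ← mul_assoc, mul_assoc _ a.1.1, haa, mul_one]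
  obtain ⟨S, hS, hSa⟩ := exists_skew_matrix hε (by rw [mul_smul_comm, haa])
    (by rw [smul_mul_assoc, haa']) c.1.mul_inv c.1.inv_mul hca hca'
  let s : SLQuat n := ⟨⟨S, -S, by rw [mul_neg, hS, neg_neg], by rw [neg_mul, hS, neg_neg]⟩,
    quatDet_eq_one_of_mul_self_eq_neg_one hS⟩
  refine ⟨(s : PSLQuat n), ?_, ?_⟩
  · change (s : PSLQuat n) ^ 2 = 1
    rw [pow_two]
    -- The square is `-I`, which is trivial only in the quotient.
    refine quotient_eq_of_eq_smul (a := s * s) (b := 1) (Or.inr rfl) ?_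
    change S * S = (-1 : ℝ) • 1
    rw [hS, neg_one_smul]
  · refine quotient_eq_of_eq_smul (a := s * a * s⁻¹) (b := a⁻¹) hε ?_
    change S * a.1.1 * -S = ε • a⁻¹.1.1
    rw [hSa, mul_assoc, mul_neg, hS, neg_neg, mul_one]
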